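/- Let $\mathbb F_q$ be a finite field and let $[n]=\{1,\dots,n\}$. An $(n,k,\ell,m,r)_q$-secret sharing scheme is a randomized encoder $f$ that maps a uniformly distributed secret $\mathbf S\in\mathbb F_q^k$ to shares $\mathbf C=f(\mathbf S)\in\mathbb F_q^n$ such that (entropies in base $q$) (recovery) $H(\mathbf S\mid \mathbf C_I)=0$ for all $I\subseteq[n]$ with $|I|=m$; (security) $H(\mathbf S\mid \mathbf C_J)=H(\mathbf S)$ for all $J\subseteq[n]$ with $|J|=\ell$; (locality) for every $i\in[n]$ there is $R_i\subseteq[n]\setminus\{i\}$ with $|R_i|\le r$ and $H(C_i\mid \mathbf C_{R_i})=0$. A linear $(n,K,r)_q$-optimal LRC is a linear code $\mathcal C\subseteq\mathbb F_q^n$ with $|\mathcal C|=q^K$, such that for every $i$ there is $R_i\subseteq[n]\setminus\{i\}$ with $|R_i|\le r$ and $u_i\ne v_i\Rightarrow u_{R_i}\ne v_{R_i}$ for all $u,v\in\mathcal C$, and whose minimum distance is $n-K-\lceil K/r\rceil+2$. **Theorem.** Let $n,k,\ell,m,r$ be non-negative integers with $r\ge 1$, $m\le n$ and $$k+\ell+\Big\lceil\frac{k+\ell}{r}\Big\rceil-1=m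 .$$ 1. If $(r+1)\mid n$, then for some prime power $q$ there exists an $(n,k,\ell,m,r)_q$-secret sharing scheme. 2. (Gabidulin precoding.) If $(r+1)\mid n$, then over some finite field there is a linear $(n,k+\ell,r)$-optimal LRC. Moreover, whether or not $(r+1)\mid n$, let $G=(g_{ij})\in\mathbb F_q^{n\times(k+\ell)}$ be a generator matrix of any linear $(n,k+\ell,r)_q$-optimal LRC, let $\mathbb F_{q^N}$ be a finite extension of $\mathbb F_q$, and let $\alpha_1,\dots,\alpha_{k+\ell}\in\mathbb F_{q^N}$ be $\mathbb F_q$-linearly independent. For a secret $\mathbf s\in\mathbb F_{q^N}^k$, choose $\mathbf r\in\mathbb F_{q^N}^\ell$ uniformly at random, put $\mathbf a=(\mathbf r,\mathbf s)$ and $\Psi_{\mathbf a}(y)=\sum_{i=1}^{k+\ell}a_i y^{q^{i-1}}$, and let the shares be $c_i=\sum_{j=1}^{k+\ell}g_{ij}\Psi_{\mathbf a}(\alpha_j)$, $i\in[n]$. This is an $(n,k,\ell,m,r)_{q^N}$-secret sharing scheme. 3. (Random linear network code.) Let $n=g(r+1)$ and divide the shares into $g$ repair groups of $r+1$ consecutive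 shares. Consider linear network codes over $\mathbb F_q$ of the following kind. The source has symbols $a_0,\dots,a_{k+\ell-1}$. There are nodes $F_0,\dots,F_{r-1}$, and $F_\nu$ receives the symbols $a_t$ with $t\equiv\nu\pmod r$. Each $F_\nu$ sends one linear combination $z_{\rho,\nu}=\sum_{t\equiv\nu\,(r)}d_{\rho,t}a_t$ of them to each repair group $\rho$. Share $i$, in group $\rho$, is $c_i=\sum_{\nu}w_{i,\nu}z_{\rho,\nu}$. The first $\ell$ source symbols are independent uniform random elements of $\mathbb F_q$, and the other $k$ are the secret. For every $\varepsilon>0$ there is $q_0$, depending only on $n,k,\ell,m,r,\varepsilon$, such that for every prime power $q\ge q_0$, if all coefficients $d_{\rho,t},w_{i,\nu}\in\mathbb F_q$ are chosen independently and uniformly at random, the result is an $(n,k,\ell,m,r)_q$-secret sharing scheme with probability at least $1-\varepsilon$. -/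

import Mathlib

namespace LocalSecretSharing

section Entropy

variable {Ω A B : Type} [Fintype A] [Fintype B]

/-- The probability that the random variable `X` takes the value `a` under the law `P`. -/
noncomputable def prob (P : PMF Ω) (X : Ω → A) (a : A) : ℝ := ((P.map X) a).toReal

/-- Shannon entropy (in base `q`) of the finitely-valued random variable `X`. -/
noncomputable def entropy (q : ℕ) (P : PMF Ω) (X : Ω → A) : ℝ :=
  ∑ a, -(prob P X a * Real.logb q (prob P X a))

/-- Conditional Shannon entropy `H(X | Y)` in base `q`,
`- ∑ p(a, b) log_q (p(a, b) / p(b))`, with `0 log 0 = 0`. -/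
noncomputable def condEntropy (q : ℕ) (P : PMF Ω) (X : Ω → A) (Y : Ω → B) : ℝ :=
  ∑ a, ∑ b, -(prob P (fun ω => (X ω, Y ω)) (a, b) *
    Real.logb q (prob P (fun ω => (X ω, Y ω)) (a, b) / prob P Y b))

end Entropy

section Scheme

variable {F : Type} [Fintype F] [Nonempty F] {n k : ℕ}

/-- The joint law of the uniform secret `S` and the share vector `C = f(S)`, where `f` is a
randomized encoder (for each secret, a probability distribution on share vectors). -/
noncomputable def jointLaw (f : (Fin k → F) → PMF (Fin n → F)) :
    PMF ((Fin k → F) × (Fin n → F)) :=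
  (PMF.uniformOfFintype (Fin k → F)).bind fun s => (f s).map fun c => (s, c)

/-- The random variable `S` (the secret). -/
def secretRV : (Fin k → F) × (Fin n → F) → (Fin k → F) := fun ω => ω.1

/-- The random variable `C_I` (the shares with index in `I`). -/
def sharesRV (I : Finset (Fin n)) : (Fin k → F) × (Fin n → F) → (I → F) := fun ω i => ω.2 i

/-- The random variable `C_i` (a single share). -/
def shareRV (i : Fin n) : (Fin k → F) × (Fin n → F) → F := fun ω => ω.2 i

/-- The randomized encoder `f` is an `(n, k, ℓ, m, r)_q`-secret sharing scheme, `q = |F|`. -/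
structure IsSecretSharingScheme (ℓ m r : ℕ) (f : (Fin k → F) → PMF (Fin n → F)) : Prop where
  recovery : ∀ I : Finset (Fin n), I.card = m →
    condEntropy (Fintype.card F) (jointLaw f) secretRV (sharesRV I) = 0
  security : ∀ J : Finset (Fin n), J.card = ℓ →
    condEntropy (Fintype.card F) (jointLaw f) secretRV (sharesRV J) =
      entropy (Fintype.card F) (jointLaw f) secretRV
  locality : ∀ i : Fin n, ∃ R : Finset (Fin n), i ∉ R ∧ R.card ≤ r ∧
    condEntropy (Fintype.card F) (jointLaw f) (shareRV i) (sharesRV R) = 0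

end Scheme

section Codes

variable {F : Type} [Fintype F] {n : ℕ}

/-- The code `C ⊆ Fⁿ` has locality `r`. -/
def HasLocality (C : Set (Fin n → F)) (r : ℕ) : Prop :=
  ∀ i : Fin n, ∃ R : Finset (Fin n), i ∉ R ∧ R.card ≤ r ∧
    ∀ u ∈ C, ∀ v ∈ C, u i ≠ v i → ∃ j ∈ R, u j ≠ v j

open Classical in
/-- The code `C ⊆ Fⁿ` has minimum (Hamming) distance `d`. -/
def HasMinDist (C : Set (Fin n → F)) (d : ℕ) : Prop :=
  IsLeast {e : ℕ | ∃ u ∈ C, ∃ v ∈ C, u ≠ v ∧ hammingDist u v = e} d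

/-- `C` is an `(n, K, r)_q`-optimal locally repairable code: it has `q ^ K` words, locality `r`
and minimum distance `d = n - K - ⌈K / r⌉ + 2`. -/
def IsOptimalLRC (C : Set (Fin n → F)) (K r : ℕ) : Prop :=
  C.ncard = Fintype.card F ^ K ∧ HasLocality C r ∧
    ∃ d : ℕ, HasMinDist C d ∧ d + K + ⌈(K : ℚ) / r⌉₊ = n + 2

/-- `G`, an `n × K` matrix over `F`, generates a linear `(n, K, r)_q`-optimal LRC. -/
def GeneratesOptimalLRC [Field F] {K : ℕ} (G : Matrix (Fin n) (Fin K) F) (r : ℕ) : Prop :=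
  IsOptimalLRC (Set.range fun x : Fin K → F => G.mulVec x) K r

end Codes

section Gabidulin

/-- The linearized polynomial `Ψ_a(y) = ∑_i a_i y^(q^i)` (`0 ≤ i < K`), evaluated at `y`. -/
def linearizedEval {L : Type} [Field L] (q : ℕ) {K : ℕ} (a : Fin K → L) (y : L) : L :=
  ∑ i : Fin K, a i * y ^ q ^ (i : ℕ)

/-- Gabidulin precoding followed by the linear code with generator matrix `G` over `F`: the input
`a = (ρ, s)`, with `ρ` uniform on `L^ℓ`, is replaced by the evaluations `Ψ_a(α_j)`,
and these are encoded `F`-linearly by `G`. -/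
noncomputable def gabidulinEncoder {F L : Type} [Field F] [Fintype F] [Field L] [Fintype L]
    [Algebra F L] {n k ℓ : ℕ} (G : Matrix (Fin n) (Fin (ℓ + k)) F) (α : Fin (ℓ + k) → L)
    (s : Fin k → L) : PMF (Fin n → L) :=
  (PMF.uniformOfFintype (Fin ℓ → L)).map fun ρ i =>
    ∑ j, G i j • linearizedEval (Fintype.card F) (Fin.append ρ s) (α j)

end Gabidulin

section Network

/-- The coding coefficients of a linear network code on the flow graph with source `X`,
intermediate nodes `F_ν` (`ν < r`), repair-group nodes `Γ_ρ` (`ρ < g`), and share nodes `Y_i`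
(`i < n`), `r + 1` consecutive ones in each repair group.

The source has one unit edge for each of the `K` symbols; the edge of symbol `t` goes to `F_ν`
with `ν = t mod r`. `toGroup ρ t` is the coefficient that symbol `t` gets on the unit
edge from `F_(t mod r)` to `Γ_ρ`. All `r` symbols received by `Γ_ρ` are available at the
share nodes of the group, and `toShare i ν` is the coefficient that the symbol received over
`(F_ν, Γ_ρ)` gets in the share `i`. -/
structure NetworkCode (F : Type) (n K r g : ℕ) where
  toGroup : Fin g → Fin K → F
  toShare : Fin n → Fin r → F

/-- The symbol transmitted on the edge `(F_ν, Γ_ρ)` on source input `a`. -/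
def NetworkCode.groupSymbol {F : Type} [Field F] {n K r g : ℕ} (c : NetworkCode F n K r g)
    (a : Fin K → F) (ρ : Fin g) (ν : Fin r) : F :=
  ∑ t : Fin K, if (t : ℕ) % r = ν then c.toGroup ρ t * a t else 0

/-- The repair group of the share `i`. -/
def repairGroup {n r g : ℕ} (hg : n = g * (r + 1)) (i : Fin n) : Fin g :=
  ⟨(i : ℕ) / (r + 1), Nat.div_lt_of_lt_mul (by
    have h := i.isLt
    rw [Nat.mul_comm]
    omega)⟩

/-- The share `i` (the symbol on the outgoing edge of `Y_i`) on source input `a`. -/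
def NetworkCode.share {F : Type} [Field F] {n K r g : ℕ} (c : NetworkCode F n K r g)
    (hg : n = g * (r + 1)) (a : Fin K → F) (i : Fin n) : F :=
  ∑ ν : Fin r, c.toShare i ν * c.groupSymbol a (repairGroup hg i) ν

/-- The randomized encoder given by a network code: the first `ℓ` source symbols are uniformly
random, the other `k` are the secret. -/
noncomputable def NetworkCode.encoder {F : Type} [Field F] [Fintype F] {n k ℓ r g : ℕ}
    (c : NetworkCode F n (ℓ + k) r g) (hg : n = g * (r + 1)) (s : Fin k → F) :
    PMF (Fin n → F) :=
  (PMF.uniformOfFintype (Fin ℓ → F)).map fun ρ => c.share hg (Fin.append ρ s)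

end Network

end LocalSecretSharing

/-! Write `K = ℓ + k`. For a linear encoder the entropy conditions follow from three facts of linear
algebra (`isSecretSharingScheme_of_linear`): any `m` shares determine the input, every pattern of
values on `ℓ` shares is already produced with zero secret, and each share vanishes once at most `r`
suitable others do. The second fact gives security because changing the secret then only translates
the uniform randomness.

Gabidulin precoding: `Ψ_a` is `F`-linear, so share `i` is `Ψ_a` evaluated at `∑ j, G i j • α j`. The
distance `n + 1 - m` of the code returns the values `Ψ_a(α_j)`, and these determine `a` because a
nonzero linearized polynomial of `q`-degree below `K` has too few roots. Any `ℓ` shares are values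
at `ℓ` points, where a polynomial of `q`-degree below `ℓ` can take the same values.

Network codes: list in increasing order some shares that contain no complete repair group. The minor
of these rows and of equally many leading source symbols is a nonzero polynomial in the
coefficients, since some integer choice makes it the identity matrix. By Schwartz–Zippel most codes
over a large field are generic: none of these minors vanishes, nor do the `r × r` minors of the
share coefficients. Among `m` shares at most `m - K` groups are complete, so dropping one share from
each leaves at least `K` shares, enough for recovery. From `ℓ` shares the same thinning leaves at
most `ℓ`, whose values the leading random symbols can produce; the dropped shares follow by repair.

A generic network code gives both existence statements. It is an optimal LRC because a dimension
count yields a nonzero word with `m - 1` zeros. -/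

namespace LocalSecretSharing

/-! ### Conditional entropy in the two extreme cases. -/

section EntropyLemmas

variable {Ω A B : Type} [Fintype A] [Fintype B]

/-- If `Y` determines `X` almost surely, then `H(X | Y) = 0`. -/
theorem condEntropy_eq_zero_of_determines (q : ℕ) (P : PMF Ω) (X : Ω → A) (Y : Ω → B)
    (h : ∀ ω ∈ P.support, ∀ ω' ∈ P.support, Y ω = Y ω' → X ω = X ω') :
    condEntropy q P X Y = 0 := by
  classical
  unfold condEntropy
  refine Finset.sum_eq_zero fun a _ => Finset.sum_eq_zero fun b _ => ?_
  by_cases h0 : prob P (fun ω => (X ω, Y ω)) (a, b) = 0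
  · simp [h0]
  have hmem : (a, b) ∈ (P.map fun ω => (X ω, Y ω)).support := by
    rw [PMF.mem_support_iff]
    intro h1
    exact h0 (by simp [prob, h1])
  obtain ⟨ω₀, hω₀, he⟩ := (PMF.mem_support_map_iff _ _ _).1 hmem
  obtain ⟨rfl, rfl⟩ := Prod.mk.inj he
  -- On the support, `Y ω = Y ω₀` forces `X ω = X ω₀`, so both events have the same mass and the
  -- logarithm is that of `1`.
  have heq : prob P (fun ω => (X ω, Y ω)) (X ω₀, Y ω₀) = prob P Y (Y ω₀) := by
    unfold prob
    rw [PMF.map_apply, PMF.map_apply]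
    congr 1
    refine tsum_congr fun ω => ?_
    by_cases hω : ω ∈ P.support
    · by_cases hY : Y ω₀ = Y ω
      · simp [hY, h ω₀ hω₀ ω hω hY]
      · simp [hY]
    · simp [(PMF.apply_eq_zero_iff _ _).2 hω]
  rw [heq] at h0 ⊢
  rw [div_self h0]
  simp

theorem sum_prob (P : PMF Ω) (Y : Ω → B) : ∑ b, prob P Y b = 1 := by
  unfold prob
  rw [← ENNReal.toReal_sum fun b _ => PMF.apply_ne_top _ _, ← tsum_fintype (L := .unconditional _),
    PMF.tsum_coe, ENNReal.toReal_one]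

/-- If `X` and `Y` are independent, then `H(X | Y) = H(X)`. -/
theorem condEntropy_eq_entropy_of_indep (q : ℕ) (P : PMF Ω) (X : Ω → A) (Y : Ω → B)
    (h : ∀ a b, prob P (fun ω => (X ω, Y ω)) (a, b) = prob P X a * prob P Y b) :
    condEntropy q P X Y = entropy q P X := by
  unfold condEntropy entropy
  refine Finset.sum_congr rfl fun a _ => ?_
  calc
    _ = ∑ b, prob P Y b * -(prob P X a * Real.logb q (prob P X a)) := by
      refine Finset.sum_congr rfl fun b _ => ?_
      rw [h]
      by_cases hb : prob P Y b = 0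
      · simp [hb]
      · rw [mul_div_cancel_right₀ _ hb]
        ring
    _ = _ := by rw [← Finset.sum_mul, sum_prob, one_mul]

end EntropyLemmas

/-! ### The joint law of secret and shares. -/

section LinearSchemes

theorem map_equiv_uniformOfFintype {U : Type} [Fintype U] [Nonempty U] (e : U ≃ U) :
    (PMF.uniformOfFintype U).map e = PMF.uniformOfFintype U := by
  classical
  ext u
  rw [PMF.map_apply, tsum_eq_single (e.symm u)]
  · simp
  · intro v hv
    rw [if_neg]
    rintro rfl
    simp at hv

variable {F : Type} [Fintype F] [Nonempty F] {n k : ℕ}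

theorem mem_support_jointLaw {f : (Fin k → F) → PMF (Fin n → F)}
    {ω : (Fin k → F) × (Fin n → F)} (hω : ω ∈ (jointLaw f).support) :
    ω.2 ∈ (f ω.1).support := by
  unfold jointLaw at hω
  obtain ⟨s, -, hs⟩ := (PMF.mem_support_bind_iff _ _ _).1 hω
  obtain ⟨c, hc, rfl⟩ := (PMF.mem_support_map_iff _ _ _).1 hs
  exact hc

/-- If the law of the shares in `J` does not depend on the secret, these shares reveal nothing. -/
theorem condEntropy_secret_eq_entropy (f : (Fin k → F) → PMF (Fin n → F)) (J : Finset (Fin n))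
    (Q : PMF (J → F)) (h : ∀ s, (f s).map (fun c (i : J) => c i) = Q) (q : ℕ) :
    condEntropy q (jointLaw f) secretRV (sharesRV J) = entropy q (jointLaw f) secretRV := by
  classical
  refine condEntropy_eq_entropy_of_indep _ _ _ _ fun a b => ?_
  have hS : (jointLaw f).map secretRV = PMF.uniformOfFintype (Fin k → F) := by
    unfold jointLaw
    rw [PMF.map_bind]
    simp_rw [PMF.map_comp]
    have : ∀ s : Fin k → F, (secretRV ∘ fun c : Fin n → F => (s, c)) = Function.const _ s :=
      fun s => rfl
    simp_rw [this, PMF.map_const, PMF.bind_pure]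
  have hC : (jointLaw f).map (sharesRV J) = Q := by
    unfold jointLaw
    rw [PMF.map_bind]
    simp_rw [PMF.map_comp]
    have : ∀ s : Fin k → F, (sharesRV J ∘ fun c : Fin n → F => (s, c)) =
      fun c (i : J) => c i := fun s => rfl
    simp_rw [this, h, PMF.bind_const]
  have hSC : (jointLaw f).map (fun ω => (secretRV ω, sharesRV J ω)) =
      (PMF.uniformOfFintype (Fin k → F)).bind fun s => Q.map fun c => (s, c) := by
    unfold jointLaw
    rw [PMF.map_bind]
    congr 1
    funext s
    rw [← h s, PMF.map_comp, PMF.map_comp]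
    rfl
  unfold prob
  rw [hS, hC, hSC, ← ENNReal.toReal_mul, PMF.bind_apply, tsum_eq_single a]
  · congr 2
    rw [PMF.map_apply, tsum_eq_single b]
    · simp
    · intro c hc
      simp [hc.symm]
  · intro s hs
    rw [PMF.map_apply]
    simp [hs.symm]

end LinearSchemes

/-! ### Secret sharing by linear encoders. -/

section LinearSchemes

/-- Serves the security arguments: `ℓ` shares may impose only `s ≤ ℓ` independent conditions, and a
solution in the first `s` random symbols is padded with zeros. -/
theorem sum_mul_append_extend {F : Type} [Semiring F] {s ℓ k : ℕ} (hs : s ≤ ℓ)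
    (f : Fin (ℓ + k) → F) (v : Fin s → F) :
    ∑ t, f t * Fin.append (fun i : Fin ℓ => if h : (i : ℕ) < s then v ⟨i, h⟩ else 0)
      (0 : Fin k → F) t = ∑ b, f (Fin.castLE (hs.trans (Nat.le_add_right ℓ k)) b) * v b := by
  obtain ⟨e, rfl⟩ := Nat.exists_eq_add_of_le hs
  rw [Fin.sum_univ_add, Fin.sum_univ_add]
  simp only [Fin.append_left, Fin.append_right, Pi.zero_apply, mul_zero, Finset.sum_const_zero,
    add_zero, Fin.val_castAdd, Fin.val_natAdd, Nat.not_lt.2 (Nat.le_add_right s _), dite_false,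
    Fin.is_lt, dite_true, Fin.eta]
  rfl

variable {F : Type} [Field F] [Fintype F] {n k ℓ m r : ℕ}

/-- Any `m` coordinates of `E a` determine `a`. -/
def Recovers {V : Type} [AddCommGroup V] (E : V → Fin n → F) (m : ℕ) : Prop :=
  ∀ I : Finset (Fin n), I.card = m → ∀ a, (∀ i ∈ I, E a i = 0) → a = 0

/-- Every coordinate of `E a` vanishes as soon as certain `r` others do. -/
def Repairs {V : Type} (E : V → Fin n → F) (r : ℕ) : Prop :=
  ∀ i : Fin n, ∃ R : Finset (Fin n), i ∉ R ∧ R.card ≤ r ∧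
    ∀ a, (∀ j ∈ R, E a j = 0) → E a i = 0

/-- A linear encoder with `ℓ` random symbols and `k` secret ones is a secret sharing scheme if
any `m` shares determine the input, if the random symbols alone produce all the values that any
`ℓ` shares take, and if each share can be repaired from `r` others. -/
theorem isSecretSharingScheme_of_linear (E : (Fin (ℓ + k) → F) →ₗ[F] (Fin n → F))
    (hrec : Recovers E m)
    (hsec : ∀ J : Finset (Fin n), J.card = ℓ → ∀ a, ∃ ρ : Fin ℓ → F,
      ∀ i ∈ J, E (Fin.append ρ 0) i = E a i)
    (hloc : Repairs E r) :
    IsSecretSharingScheme ℓ m r fun s : Fin k → F =>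
      (PMF.uniformOfFintype (Fin ℓ → F)).map fun ρ => E (Fin.append ρ s) := by
  have hsupp : ∀ ω ∈ (jointLaw fun s : Fin k → F =>
      (PMF.uniformOfFintype (Fin ℓ → F)).map fun ρ => E (Fin.append ρ s)).support,
      ∃ ρ : Fin ℓ → F, ω.2 = E (Fin.append ρ ω.1) := by
    intro ω hω
    obtain ⟨ρ, -, h⟩ := (PMF.mem_support_map_iff _ _ _).1 (mem_support_jointLaw hω)
    exact ⟨ρ, h.symm⟩
  have happ : ∀ (ρ ρ' : Fin ℓ → F) (s s' : Fin k → F),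
      Fin.append (ρ + ρ') (s + s') = Fin.append ρ s + Fin.append ρ' s' := by
    intro ρ ρ' s s'
    ext i
    refine Fin.addCases (fun i => ?_) (fun i => ?_) i <;> simp
  refine ⟨fun I hI => ?_, fun J hJ => ?_, fun i => ?_⟩
  · refine condEntropy_eq_zero_of_determines _ _ _ _ fun ω hω ω' hω' hY => ?_
    obtain ⟨ρ, h⟩ := hsupp ω hω
    obtain ⟨ρ', h'⟩ := hsupp ω' hω'
    have h0 : Fin.append ρ ω.1 - Fin.append ρ' ω'.1 = 0 := by
      refine hrec I hI _ fun i hi => ?_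
      have := congrFun hY ⟨i, hi⟩
      simp only [sharesRV] at this
      rw [map_sub, Pi.sub_apply, ← h, ← h', this, sub_self]
    funext j
    have := congrFun (sub_eq_zero.1 h0) (Fin.natAdd ℓ j)
    simpa [secretRV] using this
  · refine condEntropy_secret_eq_entropy _ J
      ((PMF.uniformOfFintype (Fin ℓ → F)).map fun ρ (i : J) => E (Fin.append ρ 0) i)
      (fun s => ?_) _
    -- On `J` the secret `s` acts like the shift `ρ₀` of the randomness, and a shift preserves the
    -- uniform law. Hence the law of these shares is the one for zero secret.
    obtain ⟨ρ₀, hρ₀⟩ := hsec J hJ (Fin.append 0 s)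
    conv_rhs => rw [← map_equiv_uniformOfFintype (Equiv.addRight ρ₀)]
    rw [PMF.map_comp, PMF.map_comp]
    congr 1
    funext ρ i
    have h1 : Fin.append ρ s = Fin.append ρ 0 + Fin.append 0 s := by
      rw [← happ, add_zero, zero_add]
    have h2 : Fin.append (ρ + ρ₀) (0 : Fin k → F) = Fin.append ρ 0 + Fin.append ρ₀ 0 := by
      rw [← happ, add_zero]
    simp only [Function.comp_apply, Equiv.coe_addRight]
    rw [h1, h2, map_add, map_add, Pi.add_apply, Pi.add_apply, hρ₀ i i.2]
  · obtain ⟨R, hiR, hR, h⟩ := hloc i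
    refine ⟨R, hiR, hR, condEntropy_eq_zero_of_determines _ _ _ _ fun ω hω ω' hω' hY => ?_⟩
    obtain ⟨ρ, h1⟩ := hsupp ω hω
    obtain ⟨ρ', h1'⟩ := hsupp ω' hω'
    have h0 := h (Fin.append ρ ω.1 - Fin.append ρ' ω'.1) fun j hj => by
      have := congrFun hY ⟨j, hj⟩
      simp only [sharesRV] at this
      rw [map_sub, Pi.sub_apply, ← h1, ← h1', this, sub_self]
    rw [map_sub, Pi.sub_apply, ← h1, ← h1'] at h0
    exact sub_eq_zero.1 h0

end LinearSchemes

/-! ### Optimal locally repairable codes. -/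

section Codes

theorem hammingDist_add_card_agree {F : Type} [DecidableEq F] {n : ℕ} (u v : Fin n → F) :
    hammingDist u v + (Finset.univ.filter fun i => u i = v i).card = n := by
  have := Finset.card_filter_add_card_filter_not (s := Finset.univ) fun i => u i ≠ v i
  simpa [hammingDist] using this

variable {F : Type} [Field F] [Fintype F] {n K m r : ℕ}

/-- A linear optimal LRC recovers the message from `n - d + 1` symbols. -/
theorem GeneratesOptimalLRC.recovers {G : Matrix (Fin n) (Fin K) F}
    (hG : GeneratesOptimalLRC G r) (hm : K + ⌈(K : ℚ) / r⌉₊ = m + 1) :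
    Recovers (fun x : Fin K → F => G.mulVec x) m := by
  classical
  obtain ⟨hcard, -, d, hd, hdm⟩ := hG
  -- A code with `q ^ K` words leaves no room for two messages with the same word.
  have hinj : Function.Injective fun x : Fin K → F => G.mulVec x := by
    rw [← Set.image_univ] at hcard
    rw [← Set.injOn_univ]
    refine Set.injOn_of_ncard_image_eq ?_
    rw [hcard, Set.ncard_univ, Nat.card_eq_fintype_card]
    simp
  intro I hI a ha
  by_contra hne
  have h1 : hammingDist (G.mulVec a) (G.mulVec 0) ∈ {e : ℕ | ∃ u ∈ Set.range fun x => G.mulVec x,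
      ∃ v ∈ Set.range fun x => G.mulVec x, u ≠ v ∧ hammingDist u v = e} :=
    ⟨_, ⟨a, rfl⟩, _, ⟨0, rfl⟩, fun h => hne (hinj h), rfl⟩
  have h2 : d ≤ hammingDist (G.mulVec a) (G.mulVec 0) := hd.2 (by convert h1)
  -- `hdm` and `hm` give `d = n + 1 - m`, whereas a word with `m` zeros has weight at most `n - m`.
  have h3 := hammingDist_add_card_agree (G.mulVec a) (G.mulVec 0)
  have h4 : I.card ≤ (Finset.univ.filter fun i => G.mulVec a i = G.mulVec 0 i).card :=
    Finset.card_le_card fun i hi => by simpa using ha i hi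
  omega

theorem GeneratesOptimalLRC.repairs {G : Matrix (Fin n) (Fin K) F}
    (hG : GeneratesOptimalLRC G r) : Repairs (fun x : Fin K → F => G.mulVec x) r := by
  intro i
  obtain ⟨R, hiR, hR, h⟩ := hG.2.1 i
  refine ⟨R, hiR, hR, fun a ha => ?_⟩
  by_contra hne
  obtain ⟨j, hj, hj'⟩ := h _ ⟨a, rfl⟩ _ ⟨0, rfl⟩ (by simpa using hne)
  exact hj' (by simpa using ha j hj)

/-- A linear map into `Fⁿ` with `n` divisible by `r + 1`, in which the coordinate at the end of each
block of `r + 1` is a function of the others in the block, and any `m` coordinates determine the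
argument, generates an optimal LRC. -/
theorem generatesOptimalLRC_of_recovers {G : Matrix (Fin n) (Fin K) F}
    (hK : 0 < K) (hr : 0 < r) (hmn : m ≤ n)
    (hm : K + ⌈(K : ℚ) / r⌉₊ = m + 1)
    (hrec : Recovers (fun x : Fin K → F => G.mulVec x) m)
    (hrep : Repairs (fun x : Fin K → F => G.mulVec x) r)
    (hblock : ∀ i : Fin n, (i : ℕ) % (r + 1) = r → ∀ a : Fin K → F,
      (∀ j : Fin n, j < i → (j : ℕ) / (r + 1) = i / (r + 1) → G.mulVec a j = 0) →
        G.mulVec a i = 0) :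
    GeneratesOptimalLRC G r := by
  classical
  obtain ⟨I₀, -, hI₀⟩ := Finset.exists_subset_card_eq (s := (Finset.univ : Finset (Fin n)))
    (n := m) (by simpa using hmn)
  have hinj : Function.Injective fun x : Fin K → F => G.mulVec x := by
    intro x y hxy
    refine sub_eq_zero.1 (hrec I₀ hI₀ _ fun i _ => ?_)
    have : G.mulVec x i = G.mulVec y i := congrFun hxy i
    simp [Matrix.mulVec_sub, this]
  have hlow : ∀ a : Fin K → F, a ≠ 0 →
      (Finset.univ.filter fun i => G.mulVec a i = 0).card < m := by
    intro a ha
    by_contra! hle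
    obtain ⟨I, hI, hIc⟩ := Finset.exists_subset_card_eq hle
    exact ha (hrec I hIc a fun i hi => (Finset.mem_filter.1 (hI hi)).2)
  refine ⟨?_, ?_, n + 1 - m, ⟨?_, ?_⟩, by omega⟩
  · rw [← Set.image_univ, Set.ncard_image_of_injective _ hinj, Set.ncard_univ,
      Nat.card_eq_fintype_card]
    simp
  · intro i
    obtain ⟨R, hiR, hR, h⟩ := hrep i
    refine ⟨R, hiR, hR, ?_⟩
    rintro _ ⟨x, rfl⟩ _ ⟨y, rfl⟩ hne
    by_contra! hall
    refine hne (sub_eq_zero.1 ?_)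
    simpa [Matrix.mulVec_sub] using h (x - y) fun j hj => by
      simpa [Matrix.mulVec_sub, sub_eq_zero] using hall j hj
  -- A nonzero word with `m - 1` zeros is needed. The first `m - 1` coordinates contain `c - 1`
  -- complete blocks, whose last coordinates are redundant; this leaves at most `(m - 1) - (c - 1) =
  -- K - 1` linear conditions on `K` unknowns.
  · set c := ⌈(K : ℚ) / r⌉₊ with hc
    have hrq : (0 : ℚ) < r := by exact_mod_cast hr
    have hc1 : c * r < K + r := by
      have := Nat.ceil_lt_add_one (a := (K : ℚ) / r) (by positivity)
      rw [← hc, ← sub_lt_iff_lt_add, lt_div_iff₀ hrq, sub_mul, one_mul, sub_lt_iff_lt_add] at this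
      exact_mod_cast this
    have hc0 : 0 < c := Nat.ceil_pos.2 (by positivity)
    have hcr : (c - 1) * (r + 1) ≤ m - 1 := by
      obtain ⟨c', hc'⟩ : ∃ c', c = c' + 1 := ⟨c - 1, by omega⟩
      rw [hc'] at hc1 hm ⊢
      simp only [Nat.add_sub_cancel]
      rw [Nat.mul_add, Nat.mul_one]
      rw [Nat.add_mul] at hc1
      omega
    have hlt : ∀ j < c - 1, j * (r + 1) + r < m - 1 := by
      intro j hj
      have h1 : (j + 1) * (r + 1) ≤ (c - 1) * (r + 1) := Nat.mul_le_mul_right _ hj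
      rw [Nat.add_mul] at h1
      omega
    set Z : Finset (Fin n) := Finset.univ.filter fun i => (i : ℕ) < m - 1 with hZ
    set T : Finset (Fin n) := Z.filter fun i => ¬ (i : ℕ) % (r + 1) = r with hT
    have hZc : Z.card = m - 1 := by
      have : Z.card = (Finset.range (m - 1)).card := by
        refine Finset.card_nbij (fun i => (i : ℕ)) ?_ ?_ ?_
        · intro i hi
          simpa [hZ] using hi
        · intro i _ j _ h
          exact Fin.ext h
        · intro i hi
          have hi' : i < m - 1 := by simpa using hi
          exact ⟨⟨i, by omega⟩, by simpa [hZ] using hi', rfl⟩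
      rw [this, Finset.card_range]
    have hlast : c - 1 ≤ (Z.filter fun i : Fin n => (i : ℕ) % (r + 1) = r).card := by
      have : (Finset.univ : Finset (Fin (c - 1))).card ≤
          (Z.filter fun i : Fin n => (i : ℕ) % (r + 1) = r).card := by
        refine Finset.card_le_card_of_injOn
          (fun j => ⟨(j : ℕ) * (r + 1) + r, by have := hlt j j.2; omega⟩) ?_ ?_
        · intro j _
          simp only [Finset.coe_filter, Set.mem_ofPred_eq, hZ, Finset.mem_filter,
            Finset.mem_univ, true_and]
          refine ⟨hlt j j.2, ?_⟩
          rw [Nat.mul_comm, Nat.mul_add_mod, Nat.mod_eq_of_lt (Nat.lt_succ_self r)]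
        · intro i _ j _ h
          have h1 : (i : ℕ) * (r + 1) + r = j * (r + 1) + r := congrArg Fin.val h
          exact Fin.ext (Nat.eq_of_mul_eq_mul_right (Nat.succ_pos r) (Nat.add_right_cancel h1))
      simpa using this
    have hTc : T.card < K := by
      have := Finset.card_filter_add_card_filter_not (s := Z) fun i : Fin n => (i : ℕ) % (r + 1) = r
      rw [← hT, hZc] at this
      omega
    let φ : (Fin K → F) →ₗ[F] (T → F) :=
      LinearMap.pi fun i => (LinearMap.proj (i : Fin n)).comp G.mulVecLin
    have hker : LinearMap.ker φ ≠ ⊥ := φ.ker_ne_bot_of_finrank_lt (by simpa using hTc)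
    obtain ⟨a, ha, ha0⟩ := Submodule.exists_mem_ne_zero_of_ne_bot hker
    have hT0 : ∀ i ∈ T, G.mulVec a i = 0 := fun i hi => congrFun (LinearMap.mem_ker.1 ha) ⟨i, hi⟩
    have hZ0 : ∀ i ∈ Z, G.mulVec a i = 0 := by
      intro i hi
      by_cases hir : (i : ℕ) % (r + 1) = r
      · refine hblock i hir a fun j hj hji => hT0 j ?_
        have hi' : (i : ℕ) < m - 1 := by simpa [hZ] using hi
        have hj' : (j : ℕ) < i := hj
        simp only [hT, hZ, Finset.mem_filter, Finset.mem_univ, true_and]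
        refine ⟨by omega, fun hjr => ?_⟩
        have e1 := Nat.div_add_mod (i : ℕ) (r + 1)
        have e2 := Nat.div_add_mod (j : ℕ) (r + 1)
        rw [hji, hjr] at e2
        omega
      · exact hT0 i (by simp [hT, hi, hir])
    have hle : m - 1 ≤ (Finset.univ.filter fun i => G.mulVec a i = 0).card := by
      rw [← hZc]
      exact Finset.card_le_card fun i hi => by simpa using hZ0 i hi
    have hlo := hlow a ha0
    have hd := hammingDist_add_card_agree (G.mulVec a) 0
    -- The word of `a` has at least `m - 1` zeros by `hle` and fewer than `m` by `hlo`.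
    refine ⟨_, ⟨a, rfl⟩, _, ⟨0, rfl⟩, fun h => ha0 (hinj h), ?_⟩
    simp only [Matrix.mulVec_zero]
    simp only [Pi.zero_apply] at hd
    convert (show hammingDist (G.mulVec a) 0 = n + 1 - m by omega)
  · rintro e ⟨_, ⟨x, rfl⟩, _, ⟨y, rfl⟩, hne, rfl⟩
    have h1 := hlow (x - y) fun h => hne (by rw [sub_eq_zero.1 h])
    have h2 := hammingDist_add_card_agree (G.mulVec x) (G.mulVec y)
    simp only [Matrix.mulVec_sub, Pi.sub_apply, sub_eq_zero] at h1
    have h3 : n + 1 - m ≤ hammingDist (G.mulVec x) (G.mulVec y) := by omega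
    convert h3

end Codes

/-! ### Linearized polynomials and Gabidulin precoding. -/

section Gabidulin

variable {F L : Type} [Field F] [Fintype F] [Field L] [Algebra F L] {n k ℓ m r K : ℕ}

/-- `y ↦ Ψ_a(y)` as an `F`-linear map. -/
noncomputable def linearizedMap (F : Type) {L : Type} [Field F] [Fintype F] [Field L] [Algebra F L]
    {K : ℕ} (a : Fin K → L) : L →ₗ[F] L :=
  ∑ i : Fin K, a i • (FiniteField.frobeniusAlgHom F L ^ (i : ℕ)).toLinearMap

theorem linearizedMap_apply (a : Fin K → L) (y : L) :
    linearizedMap F a y = linearizedEval (Fintype.card F) a y := by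
  simp [linearizedMap, linearizedEval, AlgHom.coe_pow, FiniteField.coe_frobeniusAlgHom,
    pow_iterate]

theorem linearizedEval_add (q : ℕ) (a b : Fin K → L) (y : L) :
    linearizedEval q (a + b) y = linearizedEval q a y + linearizedEval q b y := by
  simp [linearizedEval, add_mul, Finset.sum_add_distrib]

theorem linearizedEval_smul (q : ℕ) (c : L) (a : Fin K → L) (y : L) :
    linearizedEval q (c • a) y = c * linearizedEval q a y := by
  simp [linearizedEval, mul_assoc, Finset.mul_sum]

/-- A linearized polynomial of `q`-degree less than `K` that vanishes at `K` linearly independent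
points is zero. -/
theorem eq_zero_of_linearizedEval_eq_zero {β : Fin K → L} (hβ : LinearIndependent F β)
    {a : Fin K → L} (ha : ∀ j, linearizedEval (Fintype.card F) a (β j) = 0) : a = 0 := by
  classical
  rcases Nat.eq_zero_or_pos K with rfl | hK
  · exact Subsingleton.elim _ _
  have hq : 1 < Fintype.card F := Fintype.one_lt_card
  let P : Polynomial L :=
    ∑ i : Fin K, Polynomial.C (a i) * Polynomial.X ^ Fintype.card F ^ (i : ℕ)
  -- By `F`-linearity `P` vanishes on the whole span of the `β j`, which has `q ^ K` points, while
  -- its degree is at most `q ^ (K - 1)`.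
  have hP : P = 0 := by
    refine Polynomial.eq_zero_of_natDegree_lt_card_of_eval_eq_zero P
      (f := fun x : Fin K → F => ∑ j, x j • β j) ?_ ?_ ?_
    · exact hβ.fintypeLinearCombination_injective
    · intro x
      have h1 : P.eval (∑ j, x j • β j) = linearizedMap F a (∑ j, x j • β j) := by
        rw [linearizedMap_apply]
        simp [P, Polynomial.eval_finsetSum, linearizedEval]
      rw [h1, map_sum]
      refine Finset.sum_eq_zero fun j _ => ?_
      rw [map_smul, linearizedMap_apply, ha, smul_zero]
    · have h1 : P.natDegree ≤ Fintype.card F ^ (K - 1) := by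
        refine Polynomial.natDegree_sum_le_of_forall_le _ _ fun i _ => ?_
        refine (Polynomial.natDegree_C_mul_X_pow_le _ _).trans ?_
        exact Nat.pow_le_pow_right hq.le (by omega)
      have h2 : Fintype.card F ^ (K - 1) < Fintype.card F ^ K :=
        Nat.pow_lt_pow_right hq (by omega)
      simpa using h1.trans_lt h2
  funext i
  have h1 : P.coeff (Fintype.card F ^ (i : ℕ)) = a i := by
    simp only [P, Polynomial.finsetSum_coeff, Polynomial.coeff_C_mul, Polynomial.coeff_X_pow]
    rw [Finset.sum_eq_single i]
    · simp
    · intro j _ hji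
      rw [if_neg, mul_zero]
      intro h
      exact hji (Fin.ext (Nat.pow_right_injective hq h).symm)
    · simp
  rw [← h1, hP]
  simp

/-- Interpolation by linearized polynomials. -/
theorem exists_linearizedEval_eq {β : Fin K → L} (hβ : LinearIndependent F β) (v : Fin K → L) :
    ∃ a : Fin K → L, ∀ j, linearizedEval (Fintype.card F) a (β j) = v j := by
  let φ : (Fin K → L) →ₗ[L] (Fin K → L) :=
    { toFun := fun a j => linearizedEval (Fintype.card F) a (β j)
      map_add' := fun a b => funext fun j => linearizedEval_add _ _ _ _
      map_smul' := fun c a => funext fun j => linearizedEval_smul _ _ _ _ }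
  have hinj : Function.Injective φ := by
    rw [injective_iff_map_eq_zero]
    exact fun a ha => eq_zero_of_linearizedEval_eq_zero hβ fun j => congrFun ha j
  obtain ⟨a, ha⟩ := LinearMap.injective_iff_surjective.1 hinj v
  exact ⟨a, fun j => congrFun ha j⟩

/-- On a finite set of at most `ℓ` points, every linearized polynomial agrees with one of
`q`-degree less than `ℓ`. -/
theorem exists_linearizedEval_append_eq (S : Finset L) (hS : S.card ≤ ℓ) (a : Fin K → L) :
    ∃ ρ : Fin ℓ → L, ∀ y ∈ S, linearizedEval (Fintype.card F) (Fin.append ρ (0 : Fin k → L)) y =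
      linearizedEval (Fintype.card F) a y := by
  -- Only the dimension of the span matters: interpolation at a basis of `V` needs at most `ℓ`
  -- coefficients, and `F`-linearity carries the agreement from the basis to all of `V`.
  let V := Submodule.span F (S : Set L)
  have : FiniteDimensional F V := FiniteDimensional.span_finset F S
  have ht : Module.finrank F V ≤ ℓ := (finrank_span_finset_le_card S).trans hS
  let b := Module.finBasis F V
  have hb : LinearIndependent F fun i => (b i : L) :=
    b.linearIndependent.map' V.subtype (Submodule.ker_subtype V)
  obtain ⟨ρ₀, hρ₀⟩ := exists_linearizedEval_eq hb
    fun i => linearizedEval (Fintype.card F) a (b i : L)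
  refine ⟨fun i => if h : (i : ℕ) < Module.finrank F V then ρ₀ ⟨i, h⟩ else 0, fun y hy => ?_⟩
  set ρ : Fin ℓ → L := fun i => if h : (i : ℕ) < Module.finrank F V then ρ₀ ⟨i, h⟩ else 0
  have hρ : ∀ y, linearizedEval (Fintype.card F) (Fin.append ρ (0 : Fin k → L)) y =
      linearizedEval (Fintype.card F) ρ₀ y := by
    intro y
    unfold linearizedEval
    simp_rw [mul_comm _ (y ^ _)]
    exact sum_mul_append_extend ht (fun i => y ^ Fintype.card F ^ (i : ℕ)) ρ₀
  have hV : ((linearizedMap F (Fin.append ρ (0 : Fin k → L)) - linearizedMap F a) ∘ₗ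
      V.subtype) = 0 := by
    refine b.ext fun i => ?_
    simp [linearizedMap_apply, hρ, hρ₀]
  have := LinearMap.congr_fun hV ⟨y, Submodule.subset_span hy⟩
  simpa [linearizedMap_apply, sub_eq_zero] using this

/-- Applying an `F`-linear functional to each symbol commutes with encoding by `G`. -/
theorem dual_sum_smul {F L : Type} [Field F] [Field L] [Algebra F L] (G : Matrix (Fin n) (Fin K) F) (φ : Module.Dual F L) (x : Fin K → L)
    (i : Fin n) : φ (∑ j, G i j • x j) = G.mulVec (fun j => φ (x j)) i := by
  simp [Matrix.mulVec, dotProduct]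

/-- An `F`-linear functional on `L` turns a word over `L` into a word over `F` with the same
generator matrix, and such functionals separate the points of `L`. -/
theorem recovers_extendScalars {F L : Type} [Field F] [Field L] [Algebra F L]
    {G : Matrix (Fin n) (Fin K) F}
    (h : Recovers (fun x : Fin K → F => G.mulVec x) m) :
    Recovers (fun (x : Fin K → L) i => ∑ j, G i j • x j) m := by
  intro I hI x hx
  funext j
  refine (Module.forall_dual_apply_eq_zero_iff F (x j)).1 fun φ => ?_
  refine congrFun (h I hI (fun j => φ (x j)) fun i hi => ?_) j
  exact (dual_sum_smul G φ x i).symm.trans ((congrArg φ (hx i hi)).trans (map_zero φ))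

theorem repairs_extendScalars {F L : Type} [Field F] [Field L] [Algebra F L]
    {G : Matrix (Fin n) (Fin K) F}
    (h : Repairs (fun x : Fin K → F => G.mulVec x) r) :
    Repairs (fun (x : Fin K → L) i => ∑ j, G i j • x j) r := by
  intro i
  obtain ⟨R, hiR, hR, hrep⟩ := h i
  refine ⟨R, hiR, hR, fun x hx => ?_⟩
  refine (Module.forall_dual_apply_eq_zero_iff F _).1 fun φ => ?_
  rw [dual_sum_smul]
  refine hrep _ fun j hj => ?_
  exact (dual_sum_smul G φ x j).symm.trans ((congrArg φ (hx j hj)).trans (map_zero φ))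

/-- Each share has two readings. As a code symbol over `L` it inherits recovery and repair from `G`;
as a value of `Ψ_a` it yields security, whatever the code is. -/
theorem isSecretSharingScheme_gabidulinEncoder [Fintype L] {G : Matrix (Fin n) (Fin (ℓ + k)) F}
    (hG : GeneratesOptimalLRC G r) (hm : ℓ + k + ⌈((ℓ + k : ℕ) : ℚ) / r⌉₊ = m + 1)
    {α : Fin (ℓ + k) → L} (hα : LinearIndependent F α) :
    IsSecretSharingScheme ℓ m r (gabidulinEncoder G α) := by
  classical
  let E : (Fin (ℓ + k) → L) →ₗ[L] (Fin n → L) :=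
    { toFun := fun a i => ∑ j, G i j • linearizedEval (Fintype.card F) a (α j)
      map_add' := fun a b => funext fun i => by
        simp [linearizedEval_add, Finset.sum_add_distrib]
      map_smul' := fun c a => funext fun i => by
        simp [linearizedEval_smul, Finset.mul_sum] }
  have hE : ∀ a i, E a i = linearizedEval (Fintype.card F) a (∑ j, G i j • α j) := by
    intro a i
    rw [← linearizedMap_apply, map_sum]
    simp only [map_smul, linearizedMap_apply]
    rfl
  refine isSecretSharingScheme_of_linear E ?_ ?_ ?_
  · intro I hI a ha
    exact eq_zero_of_linearizedEval_eq_zero hα fun j =>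
      congrFun (recovers_extendScalars (L := L) (hG.recovers hm) I hI
        (fun j => linearizedEval (Fintype.card F) a (α j)) ha) j
  · intro J hJ a
    obtain ⟨ρ, hρ⟩ := exists_linearizedEval_append_eq (F := F) (k := k) (ℓ := ℓ)
      (J.image fun i => ∑ j, G i j • α j) (Finset.card_image_le.trans hJ.le) a
    refine ⟨ρ, fun i hi => ?_⟩
    rw [hE, hE]
    exact hρ _ (Finset.mem_image_of_mem _ hi)
  · intro i
    obtain ⟨R, hiR, hR, h⟩ := repairs_extendScalars (L := L) hG.repairs i
    exact ⟨R, hiR, hR, fun a ha => h (fun j => linearizedEval (Fintype.card F) a (α j)) ha⟩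

end Gabidulin

/-! ### Random points avoid the zeros of integer polynomials. -/

section Random

theorem totalDegree_map_le {σ R S : Type} [CommSemiring R] [CommSemiring S] (f : R →+* S)
    (p : MvPolynomial σ R) : (MvPolynomial.map f p).totalDegree ≤ p.totalDegree :=
  Finset.sup_mono (MvPolynomial.support_map_subset f p)

/-- The Schwartz–Zippel lemma for finitely many integer polynomials that are nonzero over every
field: a random point over a large finite field is a zero of none of them. -/
theorem exists_forall_le_card_nonvanishing {σ ι : Type} [Fintype σ] [Finite ι]
    (p : ι → MvPolynomial σ ℤ) (hp : ∀ i, ∃ x : σ → ℤ, MvPolynomial.aeval x (p i) = 1)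
    {ε : ℝ} (hε : 0 < ε) :
    ∃ q₀ : ℕ, ∀ (F : Type) [Field F] [Fintype F], q₀ ≤ Fintype.card F →
      (1 - ε) * (Nat.card (σ → F) : ℝ) ≤
        (Nat.card {x : σ → F // ∀ i, MvPolynomial.aeval x (p i) ≠ 0} : ℝ) := by
  classical
  have := Fintype.ofFinite ι
  set D := (∏ i, p i).totalDegree
  -- One polynomial, the product of all `p i`, controls every failure; its zeros have density at
  -- most `D / q ≤ ε`.
  refine ⟨⌈(D : ℝ) / ε⌉₊, fun F _ _ hF => ?_⟩
  have hq : (0 : ℝ) < Fintype.card F := by exact_mod_cast Fintype.card_pos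
  have hD : (D : ℝ) / Fintype.card F ≤ ε := by
    rw [div_le_iff₀ hq, ← div_le_iff₀' hε]
    exact Nat.ceil_le.1 hF
  let N := Fintype.card σ
  let e : σ ≃ Fin N := Fintype.equivFin σ
  have haeval : ∀ (x : σ → F) (f : MvPolynomial σ ℤ),
      MvPolynomial.eval x (MvPolynomial.map (Int.castRingHom F) f) = MvPolynomial.aeval x f := by
    intro x f
    rw [MvPolynomial.eval_map, MvPolynomial.aeval_def, algebraMap_int_eq]
  let P : MvPolynomial (Fin N) F :=
    MvPolynomial.rename e (MvPolynomial.map (Int.castRingHom F) (∏ i, p i))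
  have hP0 : P ≠ 0 := by
    intro h
    have h1 := MvPolynomial.rename_injective e e.injective (h.trans (map_zero _).symm)
    rw [map_prod, Finset.prod_eq_zero_iff] at h1
    obtain ⟨i, -, hi⟩ := h1
    -- The value `1` survives reduction to every field, so no factor becomes zero in any
    -- characteristic.
    obtain ⟨x, hx⟩ := hp i
    have h2 := haeval (fun j => (x j : F)) (p i)
    have h3 : MvPolynomial.aeval (fun j => (x j : F)) (p i) =
        ((MvPolynomial.aeval x (p i) : ℤ) : F) := by
      have := MvPolynomial.map_aeval x (Int.castRingHom F) (p i)
      simp only [eq_intCast] at this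
      rw [this]
      simp [MvPolynomial.aeval_def, MvPolynomial.coe_eval₂Hom]
    rw [hi, h3, hx] at h2
    simp at h2
  have hdeg : P.totalDegree ≤ D :=
    (MvPolynomial.totalDegree_rename_le _ _).trans (totalDegree_map_le _ _)
  have hSZ := MvPolynomial.schwartz_zippel_totalDegree hP0 (Finset.univ : Finset F)
  have hSZ' : ((Finset.univ.filter fun f : Fin N → F => MvPolynomial.eval f P = 0).card : ℝ) ≤
      ε * (Fintype.card F : ℝ) ^ N := by
    rw [Fintype.piFinset_univ, Finset.card_univ] at hSZ
    have h1 : ((Finset.univ.filter fun f : Fin N → F => MvPolynomial.eval f P = 0).card : ℝ) /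
        (Fintype.card F : ℝ) ^ N ≤ (P.totalDegree : ℝ) / Fintype.card F := by
      have := (NNRat.cast_le (K := ℝ)).2 hSZ
      push_cast at this
      exact this
    rw [← div_le_iff₀ (pow_pos hq N)]
    refine h1.trans (le_trans ?_ hD)
    gcongr
  have hbad : (Finset.univ.filter fun x : σ → F =>
      ¬ ∀ i, MvPolynomial.aeval x (p i) ≠ 0).card ≤
      (Finset.univ.filter fun f : Fin N → F => MvPolynomial.eval f P = 0).card := by
    refine Finset.card_le_card_of_injOn (fun x => x ∘ e.symm) ?_
      (e.symm.surjective.injective_comp_right.injOn)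
    intro x hx
    have hx' : ¬ ∀ i, MvPolynomial.aeval x (p i) ≠ 0 := by simpa using hx
    push Not at hx'
    obtain ⟨i, hi⟩ := hx'
    have : MvPolynomial.eval (x ∘ e.symm) P = 0 := by
      simp only [P, MvPolynomial.eval_rename, haeval, map_prod, Function.comp_assoc,
        Equiv.symm_comp_self, Function.comp_id]
      exact Finset.prod_eq_zero (Finset.mem_univ i) hi
    simpa using this
  have hsum := Finset.card_filter_add_card_filter_not (s := (Finset.univ : Finset (σ → F)))
    fun x => ∀ i, MvPolynomial.aeval x (p i) ≠ 0
  have htot : Nat.card (σ → F) = Fintype.card F ^ N := by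
    rw [Nat.card_eq_fintype_card, Fintype.card_fun]
  rw [Finset.card_univ, ← Nat.card_eq_fintype_card, htot] at hsum
  rw [htot, Nat.card_eq_fintype_card, Fintype.card_subtype]
  have hsumR : ((Finset.univ.filter fun x : σ → F =>
      ∀ i, MvPolynomial.aeval x (p i) ≠ 0).card : ℝ) + ((Finset.univ.filter fun x : σ → F =>
      ¬ ∀ i, MvPolynomial.aeval x (p i) ≠ 0).card : ℝ) = (Fintype.card F : ℝ) ^ N := by
    exact_mod_cast hsum
  have hbadR := (Nat.cast_le (α := ℝ)).2 hbad
  push_cast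
  linarith

end Random

/-! ### Generic network codes and their minors. -/

section Network

variable {n K r g : ℕ}

/-- Applying a map to all coefficients of a network code. -/
def NetworkCode.map {R S : Type} (f : R → S) (c : NetworkCode R n K r g) :
    NetworkCode S n K r g where
  toGroup ρ t := f (c.toGroup ρ t)
  toShare i ν := f (c.toShare i ν)

/-- The coefficient of the source symbol `t` in the share `i`. -/
def NetworkCode.coeff {R : Type} [Mul R] (hr : 0 < r) (hg : n = g * (r + 1))
    (c : NetworkCode R n K r g) (i : Fin n) (t : Fin K) : R :=
  c.toShare i ⟨(t : ℕ) % r, Nat.mod_lt _ hr⟩ * c.toGroup (repairGroup hg i) t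

theorem NetworkCode.share_eq_sum_coeff {F : Type} [Field F] (hr : 0 < r) (hg : n = g * (r + 1))
    (c : NetworkCode F n K r g) (a : Fin K → F) (i : Fin n) :
    c.share hg a i = ∑ t, c.coeff hr hg i t * a t := by
  unfold NetworkCode.share NetworkCode.groupSymbol NetworkCode.coeff
  simp_rw [Finset.mul_sum]
  rw [Finset.sum_comm]
  refine Finset.sum_congr rfl fun t _ => ?_
  rw [Finset.sum_eq_single ⟨(t : ℕ) % r, Nat.mod_lt _ hr⟩]
  · simp [mul_assoc]
  · intro ν _ hν
    rw [if_neg, mul_zero]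
    intro h
    exact hν (Fin.ext h.symm)
  · simp

/-- Rows `x` of the matrix with which the shares are formed from the symbols of their group. -/
def NetworkCode.shareMinor {R : Type} (c : NetworkCode R n K r g) (x : Fin r → Fin n) :
    Matrix (Fin r) (Fin r) R :=
  Matrix.of fun j ν => c.toShare (x j) ν

/-- Rows `x` and the leading columns of the matrix with which the shares are formed from the source
symbols. -/
def NetworkCode.leadingMinor {R : Type} [Mul R] (hr : 0 < r) (hg : n = g * (r + 1))
    (c : NetworkCode R n K r g) {s : ℕ} (hs : s ≤ K) (x : Fin s → Fin n) :
    Matrix (Fin s) (Fin s) R :=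
  Matrix.of fun a b => c.coeff hr hg (x a) (Fin.castLE hs b)

/-- Shares of the same repair group have positions that are distinct modulo `r`. -/
def Spread (hg : n = g * (r + 1)) {s : ℕ} (x : Fin s → Fin n) : Prop :=
  ∀ a b : Fin s, repairGroup hg (x a) = repairGroup hg (x b) → (a : ℕ) % r = (b : ℕ) % r → a = b

/-- The minors of a network code that are not identically zero do not vanish. -/
structure NetworkCode.IsGeneric {F : Type} [Field F] (hr : 0 < r) (hg : n = g * (r + 1))
    (c : NetworkCode F n K r g) : Prop where
  shareMinor_ne : ∀ x : Fin r → Fin n, Function.Injective x → (c.shareMinor x).det ≠ 0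
  leadingMinor_ne : ∀ (s : ℕ) (hs : s ≤ K) (x : Fin s → Fin n), Function.Injective x →
    Spread hg x → (c.leadingMinor hr hg hs x).det ≠ 0

theorem NetworkCode.exists_shareMinor_eq_one (x : Fin r → Fin n) (hx : Function.Injective x) :
    ∃ c : NetworkCode ℤ n K r g, c.shareMinor x = 1 := by
  refine ⟨⟨fun _ _ => 0, fun i ν => if x ν = i then 1 else 0⟩, ?_⟩
  ext j ν
  simp [NetworkCode.shareMinor, Matrix.one_apply, hx.eq_iff, eq_comm]

/-- Route symbol `b` only to the group of share `x b`, and let share `x a` read only the node `a mod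
r`. Entry `(a, b)` is then nonzero only if `x a` and `x b` share a group and `a ≡ b` modulo `r`,
which `Spread` allows only on the diagonal. -/
theorem NetworkCode.exists_leadingMinor_eq_one (hr : 0 < r) (hg : n = g * (r + 1)) {s : ℕ}
    (hs : s ≤ K) (x : Fin s → Fin n) (hx : Function.Injective x) (hsp : Spread hg x) :
    ∃ c : NetworkCode ℤ n K r g, c.leadingMinor hr hg hs x = 1 := by
  classical
  refine ⟨⟨fun ρ t => if ∃ a : Fin s, (a : ℕ) = t ∧ repairGroup hg (x a) = ρ then 1 else 0,
    fun i ν => if ∃ a : Fin s, x a = i ∧ (a : ℕ) % r = ν then 1 else 0⟩, ?_⟩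
  ext a b
  simp only [NetworkCode.leadingMinor, NetworkCode.coeff, Matrix.of_apply, Matrix.one_apply,
    Fin.val_castLE]
  by_cases hab : a = b
  · subst hab
    rw [if_pos ⟨a, rfl, rfl⟩, if_pos ⟨a, rfl, rfl⟩, if_pos rfl, mul_one]
  · rw [if_neg hab]
    by_contra hne
    obtain ⟨h1, h2⟩ := mul_ne_zero_iff.1 hne
    rw [ne_eq, ite_eq_right_iff, not_forall] at h1 h2
    obtain ⟨⟨a', ha', hmod⟩, -⟩ := h1
    obtain ⟨⟨b', hb', hgrp⟩, -⟩ := h2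
    obtain rfl := hx ha'
    obtain rfl := Fin.ext hb'
    exact hab (hsp _ _ hgrp.symm hmod)

/-- A network code is given by its coefficients. -/
def NetworkCode.coeffEquiv (F : Type) (n K r g : ℕ) :
    NetworkCode F n K r g ≃ ((Fin g × Fin K) ⊕ (Fin n × Fin r) → F) where
  toFun c := Sum.elim (fun p => c.toGroup p.1 p.2) fun p => c.toShare p.1 p.2
  invFun v := ⟨fun ρ t => v (Sum.inl (ρ, t)), fun i ν => v (Sum.inr (i, ν))⟩
  left_inv _ := rfl
  right_inv v := by
    ext p
    cases p <;> rfl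

/-- The network code with indeterminate coefficients. -/
noncomputable def NetworkCode.universal (n K r g : ℕ) :
    NetworkCode (MvPolynomial ((Fin g × Fin K) ⊕ (Fin n × Fin r)) ℤ) n K r g :=
  (NetworkCode.coeffEquiv _ n K r g).symm MvPolynomial.X

/-- Makes each minor of a code the value of one fixed integer polynomial at the vector of its
coefficients, the same polynomial over all rings. -/
theorem NetworkCode.map_universal {R : Type} [CommRing R] (c : NetworkCode R n K r g) :
    (NetworkCode.universal n K r g).map
      (MvPolynomial.aeval (R := ℤ) (NetworkCode.coeffEquiv R n K r g c)) = c := by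
  have h := MvPolynomial.aeval_X (R := ℤ) (NetworkCode.coeffEquiv R n K r g c)
  exact congrArg₂ NetworkCode.mk (funext₂ fun ρ t => h (Sum.inl (ρ, t)))
    (funext₂ fun i ν => h (Sum.inr (i, ν)))

theorem NetworkCode.aeval_det_shareMinor {R : Type} [CommRing R] (c : NetworkCode R n K r g)
    (x : Fin r → Fin n) :
    MvPolynomial.aeval (NetworkCode.coeffEquiv R n K r g c)
      ((NetworkCode.universal n K r g).shareMinor x).det = (c.shareMinor x).det := by
  rw [AlgHom.map_det]
  conv_rhs => rw [← c.map_universal]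
  rfl

theorem NetworkCode.aeval_det_leadingMinor {R : Type} [CommRing R] (hr : 0 < r)
    (hg : n = g * (r + 1)) (c : NetworkCode R n K r g) {s : ℕ} (hs : s ≤ K) (x : Fin s → Fin n) :
    MvPolynomial.aeval (NetworkCode.coeffEquiv R n K r g c)
      ((NetworkCode.universal n K r g).leadingMinor hr hg hs x).det =
        (c.leadingMinor hr hg hs x).det := by
  rw [AlgHom.map_det]
  conv_rhs => rw [← c.map_universal]
  congr 1
  ext a b
  simp [NetworkCode.leadingMinor, NetworkCode.coeff, NetworkCode.map]

/-- Over a large finite field almost all network codes are generic. -/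
theorem NetworkCode.exists_forall_le_card_isGeneric (K : ℕ) (hr : 0 < r) (hg : n = g * (r + 1))
    {ε : ℝ} (hε : 0 < ε) :
    ∃ q₀ : ℕ, ∀ (F : Type) [Field F] [Fintype F], q₀ ≤ Fintype.card F →
      (1 - ε) * (Nat.card (NetworkCode F n K r g) : ℝ) ≤
        (Nat.card {c : NetworkCode F n K r g // c.IsGeneric hr hg} : ℝ) := by
  -- All minors required by genericity, as a finite family; `Fin (K + 1)` encodes the sizes `s ≤ K`.
  let ι : Type := {x : Fin r → Fin n // Function.Injective x} ⊕
    (Σ s : Fin (K + 1), {x : Fin s → Fin n // Function.Injective x ∧ Spread hg x})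
  let p : ι → MvPolynomial ((Fin g × Fin K) ⊕ (Fin n × Fin r)) ℤ :=
    Sum.elim (fun x => ((NetworkCode.universal n K r g).shareMinor x.1).det) fun y =>
      ((NetworkCode.universal n K r g).leadingMinor hr hg (Nat.le_of_lt_succ y.1.2) y.2.1).det
  have hp : ∀ i, ∃ x, MvPolynomial.aeval (R := ℤ) (S₁ := ℤ) x (p i) = 1 := by
    rintro (⟨x, hx⟩ | ⟨s, x, hx, hsp⟩)
    · obtain ⟨c, hc⟩ := NetworkCode.exists_shareMinor_eq_one (K := K) (g := g) x hx
      exact ⟨_, (c.aeval_det_shareMinor x).trans (by rw [hc, Matrix.det_one])⟩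
    · obtain ⟨c, hc⟩ := NetworkCode.exists_leadingMinor_eq_one hr hg (Nat.le_of_lt_succ s.2) x hx hsp
      exact ⟨_, (c.aeval_det_leadingMinor hr hg _ x).trans (by rw [hc, Matrix.det_one])⟩
  obtain ⟨q₀, h⟩ := exists_forall_le_card_nonvanishing p hp hε
  refine ⟨q₀, fun F _ _ hF => ?_⟩
  rw [Nat.card_congr (NetworkCode.coeffEquiv F n K r g)]
  refine (h F hF).trans_eq ?_
  congr 1
  refine (Nat.card_congr ((NetworkCode.coeffEquiv F n K r g).subtypeEquiv fun c => ?_)).symm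
  constructor
  · rintro hc (⟨x, hx⟩ | ⟨s, x, hx, hsp⟩)
    · exact (c.aeval_det_shareMinor x).trans_ne (hc.shareMinor_ne x hx)
    · exact (c.aeval_det_leadingMinor hr hg _ x).trans_ne (hc.leadingMinor_ne s _ x hx hsp)
  · intro hc
    exact ⟨fun x hx => (c.aeval_det_shareMinor x).symm.trans_ne (hc (Sum.inl ⟨x, hx⟩)),
      fun s hs x hx hsp => (c.aeval_det_leadingMinor hr hg hs x).symm.trans_ne
        (hc (Sum.inr ⟨⟨s, Nat.lt_succ_of_le hs⟩, x, hx, hsp⟩))⟩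

end Network

/-! ### Sets of shares without complete repair groups. -/

section RepairGroups

variable {n r g : ℕ}

/-- The share with position `p` in the repair group `ρ`. -/
def shareEquiv (hg : n = g * (r + 1)) : Fin g × Fin (r + 1) ≃ Fin n :=
  finProdFinEquiv.trans (finCongr hg.symm)

theorem shareEquiv_val (hg : n = g * (r + 1)) (ρ : Fin g) (p : Fin (r + 1)) :
    (shareEquiv hg (ρ, p) : ℕ) = p + (r + 1) * ρ := by
  simp [shareEquiv]

theorem repairGroup_shareEquiv (hg : n = g * (r + 1)) (ρ : Fin g) (p : Fin (r + 1)) :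
    repairGroup hg (shareEquiv hg (ρ, p)) = ρ := by
  apply Fin.ext
  simp only [repairGroup, shareEquiv_val]
  rw [Nat.add_mul_div_left _ _ (Nat.succ_pos r), Nat.div_eq_of_lt p.2, Nat.zero_add]

theorem strictMono_add_sub_le {s n : ℕ} {x : Fin s → Fin n} (hx : StrictMono x) {a b : Fin s}
    (hab : a ≤ b) : (x a : ℕ) + ((b : ℕ) - a) ≤ x b := by
  obtain ⟨b, hb⟩ := b
  induction b with
  | zero =>
    have : a = ⟨0, hb⟩ := le_antisymm hab (Nat.zero_le _)
    simp [this]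
  | succ b ih =>
    rcases hab.eq_or_lt with rfl | hlt
    · simp
    · have h1 := ih (by omega) (Nat.le_of_lt_succ hlt)
      have h2 : x ⟨b, by omega⟩ < x ⟨b + 1, hb⟩ := hx (Nat.lt_succ_self b)
      have h3 : (a : ℕ) < b + 1 := hlt
      have h4 := Fin.lt_def.1 h2
      simp only at h1 ⊢
      omega

/-- Increasing sequences of shares that contain no complete repair group are spread. -/
theorem spread_of_strictMono (hg : n = g * (r + 1)) {s : ℕ} {x : Fin s → Fin n}
    (hx : StrictMono x) (hinc : ∀ ρ, ∃ p, shareEquiv hg (ρ, p) ∉ Set.range x) : Spread hg x := by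
  have key : ∀ a b : Fin s, a < b → repairGroup hg (x a) = repairGroup hg (x b) →
      (a : ℕ) % r ≠ (b : ℕ) % r := by
    intro a b hab hgrp hmod
    have hlt : (a : ℕ) < b := hab
    have hdvd : r ∣ (b : ℕ) - a := (Nat.modEq_iff_dvd' hlt.le).1 hmod
    have hle : r ≤ (b : ℕ) - a := Nat.le_of_dvd (by omega) hdvd
    obtain ⟨⟨ρ, pa⟩, ha⟩ := (shareEquiv hg).surjective (x a)
    obtain ⟨⟨ρ', pb⟩, hb⟩ := (shareEquiv hg).surjective (x b)
    rw [← ha, ← hb, repairGroup_shareEquiv, repairGroup_shareEquiv] at hgrp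
    subst hgrp
    have hva := shareEquiv_val hg ρ pa
    have hvb := shareEquiv_val hg ρ pb
    rw [ha] at hva
    rw [hb] at hvb
    obtain ⟨p, hp⟩ := hinc ρ
    have hpb := pb.2
    have hp2 := p.2
    have hbs := b.2
    have hb0 := strictMono_add_sub_le hx hab.le
    -- The indices `a < b` differ by at least `r`, but the positions of `x a` and `x b` in one group
    -- differ by at most `r`. So `x` runs through the entire group without gaps from index `a` on,
    -- and hits the missing position `p` at index `a + p`.
    refine hp ⟨⟨a + p, by omega⟩, Fin.ext ?_⟩
    have h1 := strictMono_add_sub_le hx (a := a) (b := ⟨a + p, by omega⟩)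
      (Fin.le_def.2 (Nat.le_add_right _ _))
    have h2 := strictMono_add_sub_le hx (a := ⟨a + p, by omega⟩) (b := b)
      (Fin.le_def.2 (by simp only; omega))
    rw [shareEquiv_val]
    simp only at h1 h2
    omega
  intro a b hgrp hmod
  rcases lt_trichotomy a b with h | h | h
  · exact absurd hmod (key a b h hgrp)
  · exact h
  · exact absurd hmod.symm (key b a h hgrp.symm)

/-- Every set of shares can be thinned out to one that contains no complete repair group by
removing one share of each complete group. -/
theorem exists_subset_incomplete (hg : n = g * (r + 1)) (J : Finset (Fin n)) :
    ∃ J' ⊆ J, J.card ≤ J'.card + J.card / (r + 1) ∧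
      (∀ ρ, ∃ p, shareEquiv hg (ρ, p) ∉ J') ∧
      ∀ i ∈ J, i ∉ J' → ∀ j, j ≠ i → repairGroup hg j = repairGroup hg i → j ∈ J' := by
  classical
  -- `P` marks the share to be dropped from a group contained in `J`, namely its last one.
  let P : Fin n → Prop := fun i => ((shareEquiv hg).symm i).2 = Fin.last r ∧
    ∀ p, shareEquiv hg (((shareEquiv hg).symm i).1, p) ∈ J
  refine ⟨J.filter fun i => ¬ P i, Finset.filter_subset _ _, ?_, ?_, ?_⟩
  · have h1 := Finset.card_filter_add_card_filter_not (s := J) P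
    -- Each dropped share accounts for `r + 1` elements of `J`, and different groups are disjoint.
    have h2 : ((J.filter P) ×ˢ (Finset.univ : Finset (Fin (r + 1)))).card ≤ J.card := by
      refine Finset.card_le_card_of_injOn
        (fun q => shareEquiv hg (((shareEquiv hg).symm q.1).1, q.2)) ?_ ?_
      · rintro ⟨i, p⟩ hq
        simp only [Finset.coe_product, Set.mem_prod, Finset.mem_coe, Finset.mem_filter] at hq
        exact hq.1.2.2 p
      · rintro ⟨i, p⟩ hq ⟨i', p'⟩ hq' h
        simp only [Finset.coe_product, Set.mem_prod, Finset.mem_coe, Finset.mem_filter] at hq hq'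
        obtain ⟨h3, h4⟩ := Prod.mk.inj ((shareEquiv hg).injective h)
        refine Prod.ext ((shareEquiv hg).symm.injective (Prod.ext h3 ?_)) h4
        rw [hq.1.2.1, hq'.1.2.1]
    rw [Finset.card_product, Finset.card_univ, Fintype.card_fin] at h2
    have h3 := (Nat.le_div_iff_mul_le r.add_one_pos).2 h2
    omega
  · intro ρ
    by_cases h : ∀ p, shareEquiv hg (ρ, p) ∈ J
    · refine ⟨Fin.last r, fun hmem => (Finset.mem_filter.1 hmem).2 ?_⟩
      simpa [P] using h
    · push Not at h
      obtain ⟨p, hp⟩ := h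
      exact ⟨p, fun hmem => hp (Finset.mem_filter.1 hmem).1⟩
  · intro i hi hi' j hji hgrp
    have hP : P i := by
      by_contra hP
      exact hi' (Finset.mem_filter.2 ⟨hi, hP⟩)
    obtain ⟨⟨ρ, p⟩, rfl⟩ := (shareEquiv hg).surjective i
    obtain ⟨⟨ρ', p'⟩, rfl⟩ := (shareEquiv hg).surjective j
    rw [repairGroup_shareEquiv, repairGroup_shareEquiv] at hgrp
    subst hgrp
    simp only [P, Equiv.symm_apply_apply] at hP
    refine Finset.mem_filter.2 ⟨hP.2 p', fun hP' => hji ?_⟩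
    simp only [P, Equiv.symm_apply_apply] at hP'
    rw [hP.1, hP'.1]

end RepairGroups

/-! ### Generic codes are schemes and optimal codes. -/

section GenericCodes

variable {F : Type} [Field F] {n k ℓ m K r g : ℕ} {hr : 0 < r} {hg : n = g * (r + 1)}

/-- The shares as a linear function of the source symbols. -/
def NetworkCode.shareMap (hg : n = g * (r + 1)) (c : NetworkCode F n K r g) (hr : 0 < r) :
    (Fin K → F) →ₗ[F] (Fin n → F) :=
  (Matrix.of (c.coeff hr hg)).mulVecLin

theorem NetworkCode.shareMap_apply (c : NetworkCode F n K r g) (a : Fin K → F) (i : Fin n) :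
    c.shareMap hg hr a i = c.share hg a i := by
  rw [c.share_eq_sum_coeff hr hg]
  rfl

/-- Any `r` shares of a group determine its `r` group symbols through an invertible minor, hence
also the remaining share. -/
theorem NetworkCode.IsGeneric.share_eq_zero {c : NetworkCode F n K r g} (hc : c.IsGeneric hr hg)
    {a : Fin K → F} {ρ : Fin g} {p : Fin (r + 1)}
    (h : ∀ j, c.share hg a (shareEquiv hg (ρ, p.succAbove j)) = 0) :
    c.share hg a (shareEquiv hg (ρ, p)) = 0 := by
  have hx : Function.Injective fun j => shareEquiv hg (ρ, p.succAbove j) := by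
    intro j j' hj
    exact Fin.succAbove_right_injective (Prod.mk.inj ((shareEquiv hg).injective hj)).2
  have hz : c.groupSymbol a ρ = 0 := by
    refine Matrix.eq_zero_of_mulVec_eq_zero (hc.shareMinor_ne _ hx) ?_
    funext j
    have := h j
    unfold NetworkCode.share at this
    rw [repairGroup_shareEquiv] at this
    exact this
  unfold NetworkCode.share
  rw [repairGroup_shareEquiv]
  simp [hz]

theorem NetworkCode.IsGeneric.share_eq_zero_of_group {c : NetworkCode F n K r g}
    (hc : c.IsGeneric hr hg) {a : Fin K → F} {i : Fin n}
    (h : ∀ j, j ≠ i → repairGroup hg j = repairGroup hg i → c.share hg a j = 0) :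
    c.share hg a i = 0 := by
  obtain ⟨⟨ρ, p⟩, rfl⟩ := (shareEquiv hg).surjective i
  refine hc.share_eq_zero fun j => h _ (fun he => ?_) ?_
  · exact Fin.succAbove_ne p j (Prod.mk.inj ((shareEquiv hg).injective he)).2
  · rw [repairGroup_shareEquiv, repairGroup_shareEquiv]

theorem NetworkCode.IsGeneric.repairs {c : NetworkCode F n K r g} (hc : c.IsGeneric hr hg) :
    Repairs (c.shareMap hg hr) r := by
  classical
  intro i
  obtain ⟨⟨ρ, p⟩, rfl⟩ := (shareEquiv hg).surjective i
  refine ⟨Finset.univ.image fun j => shareEquiv hg (ρ, p.succAbove j), ?_, ?_, fun a ha => ?_⟩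
  · intro hmem
    obtain ⟨j, -, hj⟩ := Finset.mem_image.1 hmem
    exact Fin.succAbove_ne p j (Prod.mk.inj ((shareEquiv hg).injective hj)).2
  · exact Finset.card_image_le.trans (by simp)
  · rw [NetworkCode.shareMap_apply]
    refine hc.share_eq_zero fun j => ?_
    rw [← NetworkCode.shareMap_apply (hr := hr)]
    exact ha _ (Finset.mem_image_of_mem _ (Finset.mem_univ j))

/-- After thinning, at least `K` of the `m` shares remain and contain no complete group; the first
`K` of them give an invertible square system for the input. -/
theorem NetworkCode.IsGeneric.recovers {c : NetworkCode F n K r g} (hc : c.IsGeneric hr hg)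
    (hK : K ≤ m - m / (r + 1)) : Recovers (c.shareMap hg hr) m := by
  intro I hI a ha
  obtain ⟨J, hJI, hcard, hinc, -⟩ := exists_subset_incomplete hg I
  have hKJ : K ≤ J.card := by rw [hI] at hcard; omega
  have hx : StrictMono (J.orderEmbOfFin rfl ∘ Fin.castLE hKJ) :=
    (J.orderEmbOfFin rfl).strictMono.comp (Fin.strictMono_castLE hKJ)
  have hmem : ∀ b, (J.orderEmbOfFin rfl ∘ Fin.castLE hKJ) b ∈ J :=
    fun b => J.orderEmbOfFin_mem rfl _
  have hsp := spread_of_strictMono hg hx fun ρ => (hinc ρ).imp fun p hp ⟨b, hb⟩ =>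
    hp (hb ▸ hmem b)
  refine Matrix.eq_zero_of_mulVec_eq_zero (hc.leadingMinor_ne K le_rfl _ hx.injective hsp) ?_
  funext b
  exact ha _ (hJI (hmem b))

/-- The values of any `ℓ` shares of a generic code are attained with an input supported on the
first `ℓ` symbols. -/
theorem NetworkCode.IsGeneric.exists_shareMap_append_eq {c : NetworkCode F n (ℓ + k) r g}
    (hc : c.IsGeneric hr hg) {J : Finset (Fin n)} (hJ : J.card = ℓ) (a : Fin (ℓ + k) → F) :
    ∃ ρ : Fin ℓ → F, ∀ i ∈ J, c.shareMap hg hr (Fin.append ρ 0) i = c.shareMap hg hr a i := by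
  obtain ⟨J', hJ', -, hinc, hrest⟩ := exists_subset_incomplete hg J
  have hs : J'.card ≤ ℓ := hJ ▸ Finset.card_le_card hJ'
  let x := J'.orderEmbOfFin rfl
  have hsp : Spread hg x := spread_of_strictMono hg x.strictMono fun ρ =>
    (hinc ρ).imp fun p hp ⟨b, hb⟩ => hp (hb ▸ J'.orderEmbOfFin_mem rfl b)
  -- The columns belong to the first `J'.card ≤ ℓ` source symbols, all of them random; solving in
  -- these alone leaves the secret part zero.
  have hdet := hc.leadingMinor_ne J'.card (hs.trans (Nat.le_add_right ℓ k)) x x.injective hsp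
  set M := c.leadingMinor hr hg (hs.trans (Nat.le_add_right ℓ k)) x with hM
  let v := M⁻¹.mulVec fun b => c.shareMap hg hr a (x b)
  have hv : M.mulVec v = fun b => c.shareMap hg hr a (x b) := by
    rw [Matrix.mulVec_mulVec, Matrix.mul_nonsing_inv _ (isUnit_iff_ne_zero.2 hdet),
      Matrix.one_mulVec]
  refine ⟨fun i => if h : (i : ℕ) < J'.card then v ⟨i, h⟩ else 0, ?_⟩
  set ρ : Fin ℓ → F := fun i => if h : (i : ℕ) < J'.card then v ⟨i, h⟩ else 0
  have hin : ∀ i ∈ J', c.shareMap hg hr (Fin.append ρ 0) i = c.shareMap hg hr a i := by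
    intro i hi
    obtain ⟨b, rfl⟩ : ∃ b, x b = i := by
      have : i ∈ Set.range x := by rw [Finset.range_orderEmbOfFin]; exact hi
      exact this
    refine Eq.trans ?_ (congrFun hv b)
    exact sum_mul_append_extend hs (fun t => c.coeff hr hg (x b) t) v
  intro i hi
  by_cases hi' : i ∈ J'
  · exact hin i hi'
  -- A dropped share has all other members of its group in `J'`, so the difference of the two
  -- inputs, vanishing there, vanishes at this share too.
  · rw [← sub_eq_zero, ← Pi.sub_apply, ← map_sub, NetworkCode.shareMap_apply]
    refine hc.share_eq_zero_of_group fun j hji hgrp => ?_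
    rw [← NetworkCode.shareMap_apply (hr := hr), map_sub, Pi.sub_apply, sub_eq_zero]
    exact hin j (hrest i hi hi' j hji hgrp)

theorem NetworkCode.IsGeneric.isSecretSharingScheme [Fintype F]
    {c : NetworkCode F n (ℓ + k) r g} (hc : c.IsGeneric hr hg)
    (hK : ℓ + k ≤ m - m / (r + 1)) : IsSecretSharingScheme ℓ m r (c.encoder hg) := by
  have h := isSecretSharingScheme_of_linear (c.shareMap hg hr) (hc.recovers hK)
    (fun J hJ a => hc.exists_shareMap_append_eq hJ a) hc.repairs
  convert h using 1
  funext s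
  unfold NetworkCode.encoder
  congr 1
  funext ρ i
  exact (NetworkCode.shareMap_apply _ _ _).symm

theorem NetworkCode.IsGeneric.generatesOptimalLRC [Fintype F] {c : NetworkCode F n K r g}
    (hc : c.IsGeneric hr hg) (hK0 : 0 < K) (hmn : m ≤ n) (hm : K + ⌈(K : ℚ) / r⌉₊ = m + 1)
    (hK : K ≤ m - m / (r + 1)) : GeneratesOptimalLRC (Matrix.of (c.coeff hr hg)) r := by
  refine generatesOptimalLRC_of_recovers hK0 hr hmn hm (hc.recovers hK) hc.repairs
    fun i hi a h => ?_
  refine (NetworkCode.shareMap_apply (hr := hr) c a i).trans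
    (hc.share_eq_zero_of_group fun j hji hgrp => ?_)
  have hdiv : (j : ℕ) / (r + 1) = i / (r + 1) := congrArg Fin.val hgrp
  refine (NetworkCode.shareMap_apply (hr := hr) c a j).symm.trans (h j ?_ hdiv)
  have h1 := Nat.div_add_mod (i : ℕ) (r + 1)
  have h2 := Nat.div_add_mod (j : ℕ) (r + 1)
  have h3 := Nat.mod_lt (j : ℕ) r.add_one_pos
  rw [hdiv] at h2
  have h4 : (j : ℕ) ≠ i := fun h => hji (Fin.ext h)
  refine Fin.lt_def.2 ?_
  omega

end GenericCodes

/-! ### Ceiling arithmetic and the main theorem. -/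

/-- If `m = K + ⌈K / r⌉ - 1`, then among `m` shares at most `m - K` repair groups are complete. -/
theorem le_sub_div_of_add_ceil {K m r : ℕ} (hr : 0 < r) (hm : K + ⌈(K : ℚ) / r⌉₊ = m + 1) :
    K ≤ m - m / (r + 1) := by
  set c := ⌈(K : ℚ) / r⌉₊ with hc
  have h1 : K ≤ c * r := by
    have := Nat.le_ceil ((K : ℚ) / r)
    rw [← hc, div_le_iff₀ (by exact_mod_cast hr)] at this
    exact_mod_cast this
  -- From `K ≤ c * r` follows `m + 1 = K + c ≤ c * (r + 1)`. Hence `m / (r + 1) ≤ c - 1 = m - K`.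
  have h2 : m / (r + 1) < c := by
    rw [Nat.div_lt_iff_lt_mul r.add_one_pos, Nat.mul_add]
    omega
  omega

end LocalSecretSharing

theorem mainTheorem2 (n k ℓ m r : ℕ) (hr : 0 < r) (hmn : m ≤ n)
    (hm : k + ℓ + ⌈((k + ℓ : ℕ) : ℚ) / r⌉₊ = m + 1) :
    -- existence of a scheme
    ((r + 1) ∣ n →
      ∃ (F : Type) (_ : Field F) (_ : Fintype F) (f : (Fin k → F) → PMF (Fin n → F)),
        LocalSecretSharing.IsSecretSharingScheme ℓ m r f) ∧
    -- Gabidulin precoding: optimal linear codes exist, and each one yields a scheme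
    ((r + 1) ∣ n →
      ∃ (F : Type) (_ : Field F) (_ : Fintype F) (G : Matrix (Fin n) (Fin (ℓ + k)) F),
        LocalSecretSharing.GeneratesOptimalLRC G r) ∧
    (∀ (F : Type) [Field F] [Fintype F] (G : Matrix (Fin n) (Fin (ℓ + k)) F),
      LocalSecretSharing.GeneratesOptimalLRC G r →
      ∀ (L : Type) [Field L] [Fintype L] [Algebra F L] (α : Fin (ℓ + k) → L),
        LinearIndependent F α →
        LocalSecretSharing.IsSecretSharingScheme ℓ m r
          (LocalSecretSharing.gabidulinEncoder G α)) ∧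
    -- random linear network codes: almost all of them are schemes, over large fields
    (∀ (g : ℕ) (hg : n = g * (r + 1)) (ε : ℝ), 0 < ε →
      ∃ q₀ : ℕ, ∀ (F : Type) [Field F] [Fintype F], q₀ ≤ Fintype.card F →
        (1 - ε) * (Nat.card (LocalSecretSharing.NetworkCode F n (ℓ + k) r g) : ℝ) ≤
          (Nat.card {c : LocalSecretSharing.NetworkCode F n (ℓ + k) r g //
            LocalSecretSharing.IsSecretSharingScheme ℓ m r (c.encoder hg)} : ℝ)) := by
  rw [Nat.add_comm k ℓ] at hm
  -- For `ℓ + k = 0` the ceiling is `0` as well, and `hm` would read `0 = m + 1`.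
  have hK0 : 0 < ℓ + k := by
    rcases Nat.eq_zero_or_pos (ℓ + k) with h | h
    · rw [h] at hm
      simp at hm
    · exact h
  have hK := LocalSecretSharing.le_sub_div_of_add_ceil hr hm
  have hgen : (r + 1) ∣ n → ∃ (g : ℕ) (hg : n = g * (r + 1)) (F : Type) (_ : Field F)
      (_ : Fintype F) (c : LocalSecretSharing.NetworkCode F n (ℓ + k) r g),
      c.IsGeneric hr hg := by
    rintro ⟨g, hg⟩
    have hg' : n = g * (r + 1) := by rw [hg, Nat.mul_comm]
    -- With `ε = 1 / 2` the generic codes have positive density, so one exists over a large enough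
    -- prime field.
    obtain ⟨q₀, hq₀⟩ := LocalSecretSharing.NetworkCode.exists_forall_le_card_isGeneric
      (ℓ + k) hr hg' (ε := 1 / 2) (by norm_num)
    obtain ⟨q, hq, hprime⟩ := Nat.exists_infinite_primes q₀
    have : Fact q.Prime := ⟨hprime⟩
    have h := hq₀ (ZMod q) (by rwa [ZMod.card])
    refine ⟨g, hg', ZMod q, inferInstance, inferInstance, ?_⟩
    have hpos : 0 < Nat.card (LocalSecretSharing.NetworkCode (ZMod q) n (ℓ + k) r g) := by
      rw [Nat.card_congr (LocalSecretSharing.NetworkCode.coeffEquiv _ n (ℓ + k) r g)]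
      exact Nat.card_pos
    have hpos' : (0 : ℝ) < Nat.card {c : LocalSecretSharing.NetworkCode (ZMod q) n (ℓ + k) r g //
        c.IsGeneric hr hg'} :=
      lt_of_lt_of_le (mul_pos (by norm_num) (by exact_mod_cast hpos)) h
    obtain ⟨⟨c, hc⟩⟩ := (Nat.card_pos_iff.1 (by exact_mod_cast hpos')).1
    exact ⟨c, hc⟩
  refine ⟨fun h => ?_, fun h => ?_, fun F _ _ G hG L _ _ _ α hα =>
    LocalSecretSharing.isSecretSharingScheme_gabidulinEncoder hG hm hα, fun g hg ε hε => ?_⟩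
  · obtain ⟨g, hg, F, hF, hF', c, hc⟩ := hgen h
    exact ⟨F, hF, hF', c.encoder hg, hc.isSecretSharingScheme hK⟩
  · obtain ⟨g, hg, F, hF, hF', c, hc⟩ := hgen h
    exact ⟨F, hF, hF', _, hc.generatesOptimalLRC hK0 hmn hm hK⟩
  · obtain ⟨q₀, hq₀⟩ := LocalSecretSharing.NetworkCode.exists_forall_le_card_isGeneric
      (ℓ + k) hr hg hε
    refine ⟨q₀, fun F _ _ hF => (hq₀ F hF).trans ?_⟩
    have : Finite (LocalSecretSharing.NetworkCode F n (ℓ + k) r g) :=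
      Finite.of_equiv _ (LocalSecretSharing.NetworkCode.coeffEquiv F n (ℓ + k) r g).symm
    exact_mod_cast Nat.card_le_card_of_injective
      (Subtype.map id fun (c : LocalSecretSharing.NetworkCode F n (ℓ + k) r g)
        (hc : c.IsGeneric hr hg) => hc.isSecretSharingScheme hK)
      (Subtype.map_injective _ Function.injective_id)
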